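/- **Proposition 3.5 (Dolgopyat type estimate).** Let $A$ be an $N\times N$ matrix with entries in $\{0,1\}$ having a positive power $A^k$, $k\ge1$ (all entries positive). Let $X^+=\{x\in\{1,\dots,N\}^{\mathbb N}: A(x_i,x_{i+1})=1 \text{ for all } i\ge 0\}$ with the shift $\sigma(x)_i=x_{i+1}$ and the metric $d_\lambda(x,y)=\lambda^{\min\{i\,:\,x_i\ne y_i\}}$ ($x\neq y$), where $\lambda\in(0,1)$. Let $F_\lambda(X^+)$ be the space of complex-valued $d_\lambda$-Lipschitz functions on $X^+$, with supremum norm $|h|_\infty$ and Lipschitz seminorm $|h|_{\rm Lip}=\sup_{x\ne y}|h(x)-h(y)|/d_\lambda(x,y)$. Let $\varphi:X^+\to\mathbb R$, $r:X^+\to(0,\infty)$ and $\Theta:X^+\to\mathbb R^d$ be $d_\lambda$-Lipschitz. For $\psi:X^+\to\mathbb C$ put $\mathcal L_\psi h(x)=\sum_{\sigma(y)=x}e^{\psi(y)}h(y)$, and assume that $\varphi$ is normalized: $\mathcal L_\varphi 1=1$. For $b\in\mathbb R$ and $m\in\mathbb Z^d$ let $\mathcal L_{b,m}=\mathcal L_{\varphi-ibr+im\cdot\Theta}$,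 and let $|m|=\sum_j|m_j|$. Write $r_n=\sum_{i=0}^{n-1}r\circ\sigma^i$ and $\Theta_n=\sum_{i=0}^{n-1}\Theta\circ\sigma^i$. Assume that there are $n\ge1$ and points $x_1,x_2,x_3\in X^+$ with $\sigma^n(x_k)=x_k$ and $r_n(x_2)\ne r_n(x_3)$ such that, for $$\alpha=\frac{r_n(x_1)-r_n(x_2)}{r_n(x_2)-r_n(x_3)}\in\mathbb R,\qquad \beta=\frac{1}{2\pi}\big(\Theta_n(x_1)-\Theta_n(x_2)\big)-\frac{\alpha}{2\pi}\big(\Theta_n(x_2)-\Theta_n(x_3)\big)\in\mathbb R^d,$$ the point $(\alpha,\beta)$ is an inhomogeneous Diophantine number: there are $C>0$ and $\gamma>0$ with $|q\alpha+m\cdot\beta-p|\ge C(|q|+|m|)^{-\gamma}$ for all $p\in\mathbb Z$ and all $(0,0)\ne(q,m)\in\mathbb Z\times\mathbb Z^d$. Let $C_1>1$ and put $b_m=|b|+C_1|m|$. Then there exist $C_2,C_3,C_4>0$ such that for every $b\in\mathbb R$, every $0\ne m\in\mathbb Z^d$ and every $h\in F_\lambda(X^+)$, the function $\mathcal L_{b,m}^{\lfloor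 C_2\log b_m\rfloor}h$ belongs to $F_\lambda(X^+)$ and $$\big\|\mathcal L_{b,m}^{\lfloor C_2\log b_m\rfloor}h\big\|_{b_m}\le\big(1-b_m^{-C_3}\big)\,\|h\|_{b_m},\qquad\text{where } \|h\|_{b_m}=\max\Big\{|h|_\infty,\ \frac{|h|_{\rm Lip}}{C_4\,b_m}\Big\}.$$ -/

import Mathlib

namespace TorusExt

/-- The one-sided subshift of finite type `X⁺` with transition matrix `A` on the alphabet
`Fin N`. -/
def Subshift {N : ℕ} (A : Matrix (Fin N) (Fin N) ℤ) : Type :=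
  {x : ℕ → Fin N // ∀ i, A (x i) (x (i + 1)) = 1}

variable {N : ℕ} {A : Matrix (Fin N) (Fin N) ℤ}

/-- The shift map `σ(x)ᵢ = xᵢ₊₁`. -/
def shift (x : Subshift A) : Subshift A :=
  ⟨fun i => x.1 (i + 1), fun i => x.2 (i + 1)⟩

/-- The metric `d_λ(x, y) = λ ^ min {i | xᵢ ≠ yᵢ}` for `x ≠ y`, and `d_λ(x, x) = 0`. -/
noncomputable def shiftDist (lam : ℝ) (x y : Subshift A) : ℝ :=
  open Classical in if x = y then 0 else lam ^ sInf {i : ℕ | x.1 i ≠ y.1 i}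

/-- Lipschitz continuity with respect to `d_λ`, i.e. membership in `F_λ(X⁺)` (`E = ℂ`) or
`F_λ(X⁺, ℝ)` (`E = ℝ`). -/
def IsLip {E : Type*} [NormedAddCommGroup E] (lam : ℝ) (f : Subshift A → E) : Prop :=
  ∃ K : ℝ, ∀ x y, ‖f x - f y‖ ≤ K * shiftDist lam x y

/-- The supremum norm `|h|_∞`. -/
noncomputable def supNorm (h : Subshift A → ℂ) : ℝ := ⨆ x, ‖h x‖

/-- The Lipschitz seminorm `|h|_Lip`, the supremum of the difference quotients
(pairs `x = y` contribute `0 / 0 = 0`). -/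
noncomputable def lipSeminorm (lam : ℝ) (h : Subshift A → ℂ) : ℝ :=
  ⨆ p : Subshift A × Subshift A, ‖h p.1 - h p.2‖ / shiftDist lam p.1 p.2

/-- Every point has finitely many preimages, so the sum in `transfer` is a finite sum. -/
theorem finite_preimage (x : Subshift A) : {y : Subshift A | shift y = x}.Finite := by
  refine Set.Finite.of_finite_image (f := fun y : Subshift A => y.1 0) (Set.toFinite _) ?_
  intro y hy z hz h
  apply Subtype.ext
  funext i
  cases i with
  | zero => exact h
  | succ i =>
    have h1 : (shift y).1 i = (shift z).1 i := by
      rw [show shift y = x from hy, show shift z = x from hz]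
    exact h1

/-- The transfer operator `L_ψ h(x) = ∑_{σ(y) = x} e^{ψ(y)} h(y)`. -/
noncomputable def transfer (ψ : Subshift A → ℂ) (h : Subshift A → ℂ) : Subshift A → ℂ :=
  fun x => ∑ᶠ y ∈ {y : Subshift A | shift y = x}, Complex.exp (ψ y) * h y

/-- The twisted operator `L_{b,m} = L_{φ - i b r + i m·Θ}`. -/
noncomputable def twistedTransfer {d : ℕ} (φ r : Subshift A → ℝ) (Θ : Subshift A → Fin d → ℝ)
    (b : ℝ) (m : Fin d → ℤ) : (Subshift A → ℂ) → (Subshift A → ℂ) :=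
  transfer fun y => (φ y : ℂ) - Complex.I * b * r y
    + Complex.I * ∑ j, (m j : ℂ) * (Θ y j : ℂ)

/-- The norm `|m| = ∑ⱼ |mⱼ|` on `ℤᵈ`. -/
def l1Norm {d : ℕ} (m : Fin d → ℤ) : ℝ := ∑ j, |(m j : ℝ)|

/-- `b_m = |b| + C₁ |m|`. -/
def freq {d : ℕ} (C₁ b : ℝ) (m : Fin d → ℤ) : ℝ := |b| + C₁ * l1Norm m

/-- The norm `max {|h|_∞, |h|_Lip / (C₄ b_m)}`, with `B` in the role of `b_m`. -/
noncomputable def freqNorm (lam C₄ B : ℝ) (h : Subshift A → ℂ) : ℝ :=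
  max (supNorm h) (lipSeminorm lam h / (C₄ * B))

/-- `(α, β) ∈ ℝ^{d+1}` is an inhomogeneous Diophantine number. -/
def InhomDiophantine {d : ℕ} (α : ℝ) (β : Fin d → ℝ) : Prop :=
  ∃ C > (0 : ℝ), ∃ γ > (0 : ℝ), ∀ (p q : ℤ) (m : Fin d → ℤ), (q ≠ 0 ∨ m ≠ 0) →
    C * (|(q : ℝ)| + l1Norm m) ^ (-γ) ≤ |q * α + ∑ j, (m j : ℝ) * β j - p|

/-- The ratio `α = (ℓ₁ - ℓ₂) / (ℓ₂ - ℓ₃)` of the lengths `ℓₖ = r_n(xₖ)`. -/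
noncomputable def alphaOf (r : Subshift A → ℝ) (n : ℕ) (x₁ x₂ x₃ : Subshift A) : ℝ :=
  (birkhoffSum shift r n x₁ - birkhoffSum shift r n x₂) /
    (birkhoffSum shift r n x₂ - birkhoffSum shift r n x₃)

/-- `β = (θ₁ - θ₂) / 2π - α (θ₂ - θ₃) / 2π` for the holonomies `θₖ = Θ_n(xₖ)`. -/
noncomputable def betaOf {d : ℕ} (r : Subshift A → ℝ) (Θ : Subshift A → Fin d → ℝ) (n : ℕ)
    (x₁ x₂ x₃ : Subshift A) : Fin d → ℝ := fun j =>
  1 / (2 * Real.pi) * (birkhoffSum shift Θ n x₁ j - birkhoffSum shift Θ n x₂ j)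
    - 1 / (2 * Real.pi) * alphaOf r n x₁ x₂ x₃ *
      (birkhoffSum shift Θ n x₂ j - birkhoffSum shift Θ n x₃ j)

end TorusExt

/-! Put w = -b r + m·Θ. Because `φ` is normalized, the M-th iterate of the twisted operator at x is
a weighted average, over the points y with σ^M y = x, of the values h(y) rotated by exp(i w_M(y)).
For M of order log b_m every weight is at least a negative power of b_m. Hence, if the average
nearly reaches the modulus S = ‖h‖_{b_m}, each rotated value lies close to the same number of
modulus S (`norm_sub_le_of_large`).

For n-periodic P and Q there are two points over x that share a long initial word and whose phases
differ by almost w_n(P) - w_n(Q) (`exists_pair`). The Lipschitz bound makes h nearly equal at the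
two points, so alignment forces exp(i(w_n(P) - w_n(Q))) to be near 1
(`norm_exp_sub_one_le_of_large`). This is applied to the pairs (x₁, x₂) and (x₂, x₃). Subtracting α
times the second phase difference from the first eliminates b, and makes qα + m·β - p small for
integers p, q with |q| = O(b_m). The Diophantine condition bounds that quantity below by a power of
b_m (`exists_phase_gap`), a contradiction that gives the supremum half of the estimate.

The Lipschitz half is the Lasota–Yorke inequality (`norm_iterate_transfer_sub_le`): its additive
constant grows linearly in b_m, which the norm absorbs. `exists_constants` makes all requirements
compatible. -/

namespace TorusExt

variable {N : ℕ} {A : Matrix (Fin N) (Fin N) ℤ}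

/-! ### The metric of the subshift. -/

theorem shiftDist_self (lam : ℝ) (x : Subshift A) : shiftDist lam x x = 0 := by
  simp [shiftDist]

theorem shiftDist_of_ne (lam : ℝ) {x y : Subshift A} (h : x ≠ y) :
    shiftDist lam x y = lam ^ sInf {i : ℕ | x.1 i ≠ y.1 i} := by
  simp [shiftDist, h]

theorem nonempty_disagree {x y : Subshift A} (h : x ≠ y) :
    {i : ℕ | x.1 i ≠ y.1 i}.Nonempty := by
  by_contra hc
  refine h (Subtype.ext (funext fun i => ?_))
  by_contra hi
  exact hc ⟨i, hi⟩

theorem shiftDist_pos {lam : ℝ} (h0 : 0 < lam) {x y : Subshift A} (h : x ≠ y) :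
    0 < shiftDist lam x y := by
  rw [shiftDist_of_ne lam h]; positivity

theorem shiftDist_nonneg {lam : ℝ} (h0 : 0 < lam) (x y : Subshift A) :
    0 ≤ shiftDist lam x y := by
  by_cases h : x = y
  · rw [h, shiftDist_self]
  · exact (shiftDist_pos h0 h).le

theorem shiftDist_le_pow {lam : ℝ} (h0 : 0 < lam) (h1 : lam < 1) {x y : Subshift A} {k : ℕ}
    (h : ∀ i < k, x.1 i = y.1 i) : shiftDist lam x y ≤ lam ^ k := by
  by_cases hxy : x = y
  · rw [hxy, shiftDist_self]; positivity
  · rw [shiftDist_of_ne lam hxy]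
    refine pow_le_pow_of_le_one h0.le h1.le ?_
    by_contra! hlt
    exact Nat.sInf_mem (nonempty_disagree hxy) (h _ hlt)

theorem shiftDist_le_one {lam : ℝ} (h0 : 0 < lam) (h1 : lam < 1) (x y : Subshift A) :
    shiftDist lam x y ≤ 1 := by
  simpa using shiftDist_le_pow h0 h1 (x := x) (y := y) (k := 0) (by simp)

theorem shiftDist_of_zero_ne (lam : ℝ) {x y : Subshift A} (h : x.1 0 ≠ y.1 0) :
    shiftDist lam x y = 1 := by
  rw [shiftDist_of_ne lam (fun e => h (by rw [e]))]
  have : sInf {i : ℕ | x.1 i ≠ y.1 i} = 0 := Nat.sInf_eq_zero.2 (Or.inl h)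
  rw [this, pow_zero]

theorem shiftDist_le_mul_shift {lam : ℝ} (h0 : 0 < lam) (h1 : lam < 1) {x y : Subshift A}
    (h : x.1 0 = y.1 0) : shiftDist lam x y ≤ lam * shiftDist lam (shift x) (shift y) := by
  by_cases hs : shift x = shift y
  · have : x = y := by
      refine Subtype.ext (funext fun i => ?_)
      cases i with
      | zero => exact h
      | succ i => exact congrArg (fun z : Subshift A => z.1 i) hs
    rw [this, shiftDist_self, shiftDist_self, mul_zero]
  · rw [shiftDist_of_ne lam hs, ← pow_succ']
    refine shiftDist_le_pow h0 h1 fun i hi => ?_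
    cases i with
    | zero => exact h
    | succ i =>
      by_contra hne
      have := Nat.sInf_le (s := {i : ℕ | (shift x).1 i ≠ (shift y).1 i}) (m := i) hne
      omega

/-! ### Concatenation of admissible words. -/

theorem shift_iterate_apply (k : ℕ) (x : Subshift A) (i : ℕ) :
    (shift^[k] x).1 i = x.1 (i + k) := by
  induction k generalizing x with
  | zero => rfl
  | succ k ih =>
    rw [Function.iterate_succ_apply, ih]
    change x.1 (i + k + 1) = _
    rfl

/-- Prepend an admissible symbol to a point of the subshift. -/
def cons (i : Fin N) (x : Subshift A) (h : A i (x.1 0) = 1) : Subshift A :=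
  ⟨fun k => Nat.casesOn k i x.1, fun k => by
    cases k with
    | zero => exact h
    | succ k => exact x.2 k⟩

@[simp] theorem cons_zero (i : Fin N) (x : Subshift A) (h : A i (x.1 0) = 1) :
    (cons i x h).1 0 = i := rfl

@[simp] theorem shift_cons (i : Fin N) (x : Subshift A) (h : A i (x.1 0) = 1) :
    shift (cons i x h) = x := rfl

theorem cons_zero_shift (y : Subshift A) (h : A (y.1 0) ((shift y).1 0) = 1) :
    cons (y.1 0) (shift y) h = y := by
  refine Subtype.ext (funext fun i => ?_)
  cases i <;> rfl

/-- Replace the tail of `u` from index `k` on by `v`. -/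
theorem exists_prepend (k : ℕ) (u v : Subshift A) (h : u.1 k = v.1 0) :
    ∃ z : Subshift A, (∀ i ≤ k, z.1 i = u.1 i) ∧ shift^[k] z = v := by
  induction k generalizing u with
  | zero =>
    refine ⟨v, fun i hi => ?_, rfl⟩
    obtain rfl : i = 0 := by omega
    exact h.symm
  | succ k ih =>
    obtain ⟨z, hz, hs⟩ := ih (shift u) h
    refine ⟨cons (u.1 0) z (by rw [hz 0 (by omega)]; exact u.2 0), fun i hi => ?_, ?_⟩
    · cases i with
      | zero => rfl
      | succ i => exact hz i (by omega)
    · rw [Function.iterate_succ_apply, shift_cons, hs]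

/-- A nonzero entry of a matrix product has a nonzero summand, which supplies one admissible
transition at a time. -/
theorem exists_path (hA01 : ∀ i j, A i j = 0 ∨ A i j = 1) (k : ℕ) (i : Fin N) (v : Subshift A)
    (h : (A ^ k) i (v.1 0) ≠ 0) : ∃ z : Subshift A, z.1 0 = i ∧ shift^[k] z = v := by
  induction k generalizing i with
  | zero =>
    refine ⟨v, ?_, rfl⟩
    by_contra hne
    exact h (by rw [pow_zero, Matrix.one_apply_ne (Ne.symm hne)])
  | succ k ih =>
    rw [pow_succ', Matrix.mul_apply] at h
    obtain ⟨j, -, hj⟩ := Finset.exists_ne_zero_of_sum_ne_zero h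
    obtain ⟨z, hz, hs⟩ := ih j (right_ne_zero_of_mul hj)
    have h1 : A i j = 1 := (hA01 i j).resolve_left (left_ne_zero_of_mul hj)
    refine ⟨cons i z (by rw [hz]; exact h1), rfl, ?_⟩
    rw [Function.iterate_succ_apply, shift_cons, hs]

/-- Specification with gap `k`, where `A ^ k` is positive. -/
theorem exists_splice (hA01 : ∀ i j, A i j = 0 ∨ A i j = 1) {k : ℕ}
    (hk : ∀ i j, 0 < (A ^ k) i j) (a : ℕ) (u v : Subshift A) :
    ∃ z : Subshift A, (∀ i ≤ a, z.1 i = u.1 i) ∧ shift^[a + k] z = v := by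
  obtain ⟨t, ht, hts⟩ := exists_path hA01 k (u.1 a) v (hk _ _).ne'
  obtain ⟨z, hz, hs⟩ := exists_prepend a u t ht.symm
  exact ⟨z, hz, by rw [add_comm, Function.iterate_add_apply, hs, hts]⟩

/-! ### Birkhoff sums and the pair of shadowing orbits. -/

/-- A `d_λ`-Lipschitz function has Birkhoff sums of bounded variation. -/
theorem abs_birkhoffSum_sub_le {lam : ℝ} (h0 : 0 < lam) (h1 : lam < 1) {w : Subshift A → ℝ}
    {K : ℝ} (hK : 0 ≤ K) (hw : ∀ x y, |w x - w y| ≤ K * shiftDist lam x y) (k l : ℕ)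
    {x y : Subshift A} (h : ∀ i < k + l, x.1 i = y.1 i) :
    |birkhoffSum shift w k x - birkhoffSum shift w k y| ≤ K * lam ^ l / (1 - lam) := by
  induction k generalizing l with
  | zero =>
    simp only [birkhoffSum_zero, sub_self, abs_zero]
    have : 0 < 1 - lam := by linarith
    positivity
  | succ k ih =>
    rw [birkhoffSum_succ, birkhoffSum_succ]
    have e1 := ih (l := l + 1) fun i hi => h i (by omega)
    have e2 : |w (shift^[k] x) - w (shift^[k] y)| ≤ K * lam ^ l := by
      refine (hw _ _).trans (mul_le_mul_of_nonneg_left (shiftDist_le_pow h0 h1 fun i hi => ?_) hK)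
      rw [shift_iterate_apply, shift_iterate_apply]
      exact h _ (by omega)
    have e3 : K * lam ^ l / (1 - lam) = K * lam ^ l + K * lam ^ (l + 1) / (1 - lam) := by
      have : 1 - lam ≠ 0 := by linarith
      field_simp
      ring
    have e4 := abs_add_le (birkhoffSum shift w k x - birkhoffSum shift w k y)
      (w (shift^[k] x) - w (shift^[k] y))
    rw [e3, add_sub_add_comm]
    linarith

/-- Following the periodic points `P` and then `Q`, one can spend an extra period either at `P`
or at `Q`. The two resulting points are close, lie over the same `x`, and their Birkhoff sums
differ by nearly the difference of the sums over the two periodic orbits. -/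
theorem exists_pair (hA01 : ∀ i j, A i j = 0 ∨ A i j = 1) {k : ℕ}
    (hk : ∀ i j, 0 < (A ^ k) i j) {lam : ℝ} (h0 : 0 < lam) (h1 : lam < 1) {n : ℕ}
    {P Q : Subshift A} (hP : Function.IsPeriodicPt shift n P)
    (hQ : Function.IsPeriodicPt shift n Q) {s t : ℕ} (hst : s ≤ t) (x : Subshift A) :
    ∃ y y' : Subshift A, shift^[n + (s + k) + (t + k)] y = x ∧
      shift^[n + (s + k) + (t + k)] y' = x ∧ shiftDist lam y y' ≤ lam ^ s ∧
      ∀ (w : Subshift A → ℝ) (K : ℝ), 0 ≤ K → (∀ x y, |w x - w y| ≤ K * shiftDist lam x y) →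
        |(birkhoffSum shift w (n + (s + k) + (t + k)) y -
          birkhoffSum shift w (n + (s + k) + (t + k)) y') -
          (birkhoffSum shift w n P - birkhoffSum shift w n Q)| ≤ 3 * (K * lam ^ s / (1 - lam)) := by
  have hPn : ∀ i, P.1 (i + n) = P.1 i := fun i => by rw [← shift_iterate_apply, hP.eq]
  have hQn : ∀ i, Q.1 (i + n) = Q.1 i := fun i => by rw [← shift_iterate_apply, hQ.eq]
  -- The words are built backwards from `x`: `z` follows `Q` for `t` steps and then joins `x`, `p`
  -- follows `P` for `s` steps and then joins `z`. The extra period goes in front of `p` to give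
  -- `y`; for `y'` it goes between the two stretches, in front of `z`.
  obtain ⟨z, hz, hzx⟩ := exists_splice hA01 hk t Q x
  obtain ⟨p, hp, hpz⟩ := exists_splice hA01 hk s P z
  obtain ⟨y, hy, hyp⟩ := exists_prepend n P p
    (by have := hPn 0; rw [zero_add] at this; rw [this, hp 0 (by omega)])
  obtain ⟨z', hz', hzz⟩ := exists_prepend n Q z
    (by have := hQn 0; rw [zero_add] at this; rw [this, hz 0 (by omega)])
  have hpz0 : ∀ i, p.1 (i + (s + k)) = z.1 i := fun i => by rw [← shift_iterate_apply, hpz]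
  have hyp0 : ∀ i, y.1 (i + n) = p.1 i := fun i => by rw [← shift_iterate_apply, hyp]
  have hzz0 : ∀ i, z'.1 (i + n) = z.1 i := fun i => by rw [← shift_iterate_apply, hzz]
  obtain ⟨y', hy', hyz⟩ := exists_prepend (s + k) p z' (by
    have := hpz0 0
    rw [zero_add] at this
    rw [this, hz 0 (by omega), hz' 0 (by omega)])
  have hyz0 : ∀ i, y'.1 (i + (s + k)) = z'.1 i := fun i => by rw [← shift_iterate_apply, hyz]
  have hyP : ∀ i ≤ n + s, y.1 i = P.1 i := fun i hi => by
    rcases le_total i n with hin | hin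
    · exact hy i hin
    · obtain ⟨j, rfl⟩ := Nat.exists_eq_add_of_le' hin
      rw [hyp0, hp j (by omega), hPn]
  have hzQ : ∀ i ≤ n + t, z'.1 i = Q.1 i := fun i hi => by
    rcases le_total i n with hin | hin
    · exact hz' i hin
    · obtain ⟨j, rfl⟩ := Nat.exists_eq_add_of_le' hin
      rw [hzz0, hz j (by omega), hQn]
  have hpy : ∀ i ≤ s + k + t, p.1 i = y'.1 i := fun i hi => by
    rcases le_total i (s + k) with hin | hin
    · exact (hy' i hin).symm
    · obtain ⟨j, rfl⟩ := Nat.exists_eq_add_of_le' hin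
      rw [hyz0, hpz0, hz j (by omega), hzQ j (by omega)]
  have hzz'' : shift^[s + k + n] y' = z := by
    rw [add_comm, Function.iterate_add_apply, hyz, hzz]
  have hyz'' : shift^[n + (s + k)] y = z := by
    rw [add_comm, Function.iterate_add_apply, hyp, hpz]
  refine ⟨y, y', ?_, ?_, ?_, ?_⟩
  · rw [add_comm, Function.iterate_add_apply, hyz'', hzx]
  · rw [add_comm, Function.iterate_add_apply, add_comm n, hzz'', hzx]
  · refine shiftDist_le_pow h0 h1 fun i hi => ?_
    rw [hyP i (by omega), hy' i (by omega), hp i (by omega)]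
  · intro w K hK hw
    -- The common tail along `z` cancels. The factor 3 counts the remaining comparisons: `y` with
    -- `P`, `z'` with `Q`, and `p` with `y'`.
    have e1 := abs_birkhoffSum_sub_le h0 h1 hK hw n s (x := y) (y := P)
      fun i hi => hyP i (by omega)
    have e2 := abs_birkhoffSum_sub_le h0 h1 hK hw n s (x := z') (y := Q)
      fun i hi => hzQ i (by omega)
    have e3 := abs_birkhoffSum_sub_le h0 h1 hK hw (s + k) s (x := p) (y := y')
      fun i hi => hpy i (by omega)
    have f1 : birkhoffSum shift w (n + (s + k) + (t + k)) y = birkhoffSum shift w n y +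
        birkhoffSum shift w (s + k) p + birkhoffSum shift w (t + k) z := by
      rw [birkhoffSum_add, birkhoffSum_add, hyz'', hyp]
    have f2 : birkhoffSum shift w (n + (s + k) + (t + k)) y' = birkhoffSum shift w (s + k) y' +
        birkhoffSum shift w n z' + birkhoffSum shift w (t + k) z := by
      rw [add_comm n, birkhoffSum_add, birkhoffSum_add, hzz'', hyz]
    rw [f1, f2, abs_le]
    rw [abs_le] at e1 e2 e3
    constructor <;> linarith [e1.1, e1.2, e2.1, e2.2, e3.1, e3.2]

/-! ### The normalized operator as an average over preimages. -/

open Classical in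
/-- The transfer operator as a sum over the symbols that may precede `x`. -/
theorem transfer_eq_sum (ψ h : Subshift A → ℂ) (x : Subshift A) :
    transfer ψ h x = ∑ i : Fin N, if hi : A i (x.1 0) = 1 then
      Complex.exp (ψ (cons i x hi)) * h (cons i x hi) else 0 := by
  have hs : ({y : Subshift A | shift y = x} : Set (Subshift A)) =
      ((Finset.univ.filter fun i => A i (x.1 0) = 1).attach.image
        fun i : {i // i ∈ Finset.univ.filter fun i => A i (x.1 0) = 1} =>
        cons i.1 x (Finset.mem_filter.1 i.2).2 : Finset (Subshift A)) := by
    ext y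
    simp only [Set.mem_ofPred_eq, Finset.coe_image, Set.mem_image, Finset.mem_coe,
      Finset.mem_attach, true_and, Subtype.exists]
    constructor
    · rintro rfl
      exact ⟨y.1 0, Finset.mem_filter.2 ⟨Finset.mem_univ _, y.2 0⟩, cons_zero_shift y _⟩
    · rintro ⟨i, hi, rfl⟩
      rfl
  rw [transfer, hs, finsum_mem_coe_finset, Finset.sum_image, ← Finset.sum_filter_add_sum_filter_not
    Finset.univ (fun i => A i (x.1 0) = 1)]
  · rw [Finset.sum_eq_zero (s := Finset.univ.filter fun i => ¬ A i (x.1 0) = 1)]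
    · rw [add_zero, ← Finset.sum_attach (Finset.univ.filter fun i => A i (x.1 0) = 1)]
      refine Finset.sum_congr rfl fun i _ => ?_
      rw [dif_pos (Finset.mem_filter.1 i.2).2]
    · intro i hi
      rw [dif_neg (Finset.mem_filter.1 hi).2]
  · intro i _ j _ hij
    exact Subtype.ext (congrArg (fun z : Subshift A => z.1 0) hij)

/-- The weights `e^φ` of a normalized potential add up to one. -/
theorem sum_weights {φ : Subshift A → ℝ}
    (hφ : ∀ x, transfer (fun y => (φ y : ℂ)) (fun _ => 1) x = 1) (x : Subshift A) :
    (∑ i : Fin N, if hi : A i (x.1 0) = 1 then Real.exp (φ (cons i x hi)) else 0) = 1 := by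
  have h := hφ x
  rw [transfer_eq_sum] at h
  have h2 := congrArg Complex.re h
  rw [Complex.re_sum, Complex.one_re] at h2
  rw [← h2]
  refine Finset.sum_congr rfl fun i _ => ?_
  split_ifs with hi
  · rw [mul_one, Complex.exp_ofReal_re]
  · rfl

theorem re_exp_mul_I_le {u v : ℝ} {c z : ℂ} {S : ℝ} (hc : ‖c‖ = 1) (hz : ‖z‖ ≤ S) :
    (c * (Complex.exp (u + Complex.I * v) * z)).re ≤ Real.exp u * S := by
  refine (Complex.re_le_norm _).trans ?_
  rw [norm_mul, norm_mul, hc, one_mul, Complex.norm_exp]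
  simp only [Complex.add_re, Complex.ofReal_re, Complex.mul_re, Complex.I_re, zero_mul,
    Complex.I_im, Complex.ofReal_im, mul_zero, sub_zero, add_zero]
  gcongr

/-- A normalized twisted operator does not increase the supremum norm. -/
theorem norm_transfer_le {φ : Subshift A → ℝ}
    (hφ : ∀ x, transfer (fun y => (φ y : ℂ)) (fun _ => 1) x = 1) (w : Subshift A → ℝ)
    {h : Subshift A → ℂ} {S : ℝ} (hS : ∀ x, ‖h x‖ ≤ S) (x : Subshift A) :
    ‖transfer (fun y => (φ y : ℂ) + Complex.I * w y) h x‖ ≤ S := by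
  have hsum := sum_weights hφ x
  rw [transfer_eq_sum, ← one_mul S, ← hsum, Finset.sum_mul]
  refine (norm_sum_le _ _).trans (Finset.sum_le_sum fun i _ => ?_)
  split_ifs with hi
  · rw [norm_mul, Complex.norm_exp]
    simp only [Complex.add_re, Complex.ofReal_re, Complex.mul_re, Complex.I_re, zero_mul,
      Complex.I_im, Complex.ofReal_im, mul_zero, sub_zero, add_zero]
    exact mul_le_mul_of_nonneg_left (hS _) (Real.exp_pos _).le
  · simp

theorem norm_iterate_transfer_le {φ : Subshift A → ℝ}
    (hφ : ∀ x, transfer (fun y => (φ y : ℂ)) (fun _ => 1) x = 1) (w : Subshift A → ℝ)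
    {h : Subshift A → ℂ} {S : ℝ} (hS : ∀ x, ‖h x‖ ≤ S) (M : ℕ) (x : Subshift A) :
    ‖(transfer (fun y => (φ y : ℂ) + Complex.I * w y))^[M] h x‖ ≤ S := by
  induction M generalizing x with
  | zero => exact hS x
  | succ M ih =>
    rw [Function.iterate_succ_apply']
    exact norm_transfer_le hφ w ih x

/-! ### Alignment of the summands of a nearly maximal iterate. -/

/-- If one summand of the transfer operator is not aligned with `c⁻¹`, then the real part drops. -/
theorem re_transfer_le {φ : Subshift A → ℝ}
    (hφ : ∀ x, transfer (fun y => (φ y : ℂ)) (fun _ => 1) x = 1) (w : Subshift A → ℝ)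
    {h : Subshift A → ℂ} {S : ℝ} (hS : ∀ x, ‖h x‖ ≤ S) {c : ℂ} (hc : ‖c‖ = 1) (y : Subshift A) :
    (c * transfer (fun y => (φ y : ℂ) + Complex.I * w y) h (shift y)).re ≤
      S - Real.exp (φ y) * (S - (c * Complex.exp (Complex.I * w y) * h y).re) := by
  have hsum := sum_weights hφ (shift y)
  have hy : A (y.1 0) ((shift y).1 0) = 1 := y.2 0
  rw [transfer_eq_sum, Finset.mul_sum, Complex.re_sum,
    ← Finset.add_sum_erase _ _ (Finset.mem_univ (y.1 0)), dif_pos hy, cons_zero_shift]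
  rw [← Finset.add_sum_erase _ _ (Finset.mem_univ (y.1 0)), dif_pos hy, cons_zero_shift] at hsum
  have h1 : ∀ i ∈ Finset.univ.erase (y.1 0),
      (c * (if hi : A i ((shift y).1 0) = 1 then
        Complex.exp ((φ (cons i (shift y) hi) : ℂ) + Complex.I * w (cons i (shift y) hi)) *
          h (cons i (shift y) hi) else 0)).re ≤
      (if hi : A i ((shift y).1 0) = 1 then Real.exp (φ (cons i (shift y) hi)) else 0) * S := by
    intro i _
    split_ifs with hi
    · exact re_exp_mul_I_le hc (hS _)
    · simp
  have h2 := Finset.sum_le_sum h1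
  rw [← Finset.sum_mul, eq_sub_of_add_eq' hsum] at h2
  have h3 : (c * (Complex.exp ((φ y : ℂ) + Complex.I * w y) * h y)).re =
      Real.exp (φ y) * (c * Complex.exp (Complex.I * w y) * h y).re := by
    rw [Complex.exp_add, ← Complex.ofReal_exp, ← Complex.re_ofReal_mul]
    congr 1
    ring
  rw [h3]
  linarith

/-- Only the branch through `y` is followed; all others are bounded by `S`. In the induction the
phase of the last step is absorbed into `c`, and the weights along the branch multiply to the
exponential of the Birkhoff sum. -/
theorem re_iterate_transfer_le {φ : Subshift A → ℝ}
    (hφ : ∀ x, transfer (fun y => (φ y : ℂ)) (fun _ => 1) x = 1) (w : Subshift A → ℝ)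
    {h : Subshift A → ℂ} {S : ℝ} (hS : ∀ x, ‖h x‖ ≤ S) {c : ℂ} (hc : ‖c‖ = 1) (M : ℕ)
    (y : Subshift A) :
    (c * (transfer (fun y => (φ y : ℂ) + Complex.I * w y))^[M] h (shift^[M] y)).re ≤
      S - Real.exp (birkhoffSum shift φ M y) *
        (S - (c * Complex.exp (Complex.I * birkhoffSum shift w M y) * h y).re) := by
  induction M generalizing c with
  | zero => simp
  | succ M ih =>
    rw [Function.iterate_succ_apply', Function.iterate_succ_apply']
    refine (re_transfer_le hφ w (norm_iterate_transfer_le hφ w hS M) hc (shift^[M] y)).trans ?_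
    have hc' : ‖c * Complex.exp (Complex.I * w (shift^[M] y))‖ = 1 := by
      rw [norm_mul, hc, mul_comm Complex.I, Complex.norm_exp_ofReal_mul_I, one_mul]
    have h1 := ih hc'
    have h2 : c * Complex.exp (Complex.I * w (shift^[M] y)) *
        Complex.exp (Complex.I * birkhoffSum shift w M y) * h y =
        c * Complex.exp (Complex.I * birkhoffSum shift w (M + 1) y) * h y := by
      rw [birkhoffSum_succ, Complex.ofReal_add, mul_add, Complex.exp_add]
      ring
    rw [h2] at h1
    rw [birkhoffSum_succ shift φ, Real.exp_add]
    nlinarith [Real.exp_pos (φ (shift^[M] y)), Real.exp_pos (birkhoffSum shift φ M y)]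

/-- Points over `x` at which the iterate nearly attains the bound `S` are aligned. -/
theorem norm_sub_le_of_large {φ : Subshift A → ℝ}
    (hφ : ∀ x, transfer (fun y => (φ y : ℂ)) (fun _ => 1) x = 1) {R : ℝ}
    (hR : ∀ x, -R ≤ φ x) (w : Subshift A → ℝ)
    {h : Subshift A → ℂ} {S : ℝ} (hS0 : 0 ≤ S) (hS : ∀ x, ‖h x‖ ≤ S) {c : ℂ} (hc : ‖c‖ = 1)
    {M : ℕ} {ε δ : ℝ} (hδ : 0 ≤ δ) (hεδ : 2 * ε * Real.exp (M * R) ≤ δ ^ 2) (y : Subshift A)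
    (hlarge : (1 - ε) * S ≤
      (c * (transfer (fun y => (φ y : ℂ) + Complex.I * w y))^[M] h (shift^[M] y)).re) :
    ‖c * Complex.exp (Complex.I * birkhoffSum shift w M y) * h y - S‖ ≤ δ * S := by
  have h1 := hlarge.trans (re_iterate_transfer_le hφ w hS hc M y)
  set z := c * Complex.exp (Complex.I * birkhoffSum shift w M y) * h y with hz
  have hzS : ‖z‖ ≤ S := by
    rw [hz, norm_mul, norm_mul, hc, mul_comm Complex.I, Complex.norm_exp_ofReal_mul_I]
    simpa using hS y
  have hb : -(M * R) ≤ birkhoffSum shift φ M y := by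
    rw [birkhoffSum, ← mul_neg, ← nsmul_eq_mul]
    simpa using Finset.card_nsmul_le_sum (Finset.range M) _ (-R) fun i _ => hR (shift^[i] y)
  have hre : z.re ≤ S := (Complex.re_le_norm _).trans hzS
  have h2 : Real.exp (-(M * R)) * (S - z.re) ≤ ε * S := by
    have := mul_le_mul_of_nonneg_right (Real.exp_le_exp.2 hb) (sub_nonneg.2 hre)
    linarith
  have h3 : S - z.re ≤ ε * Real.exp (M * R) * S := by
    have := mul_le_mul_of_nonneg_left h2 (Real.exp_pos (M * R)).le
    rw [← mul_assoc, ← Real.exp_add, add_neg_cancel, Real.exp_zero] at this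
    linarith
  -- As |z| ≤ S, this is at most 2S(S - Re z): a defect of order ε in the real part controls the
  -- distance only to order √ε.
  have h4 : ‖z - S‖ ^ 2 = ‖z‖ ^ 2 - 2 * S * z.re + S ^ 2 := by
    rw [← Complex.normSq_eq_norm_sq, ← Complex.normSq_eq_norm_sq, Complex.normSq_apply,
      Complex.normSq_apply]
    simp
    ring
  refine abs_le_of_sq_le_sq' ?_ (by positivity) |>.2
  rw [h4]
  nlinarith [norm_nonneg z, mul_le_mul_of_nonneg_right hεδ (sq_nonneg S)]

/-! ### Exponential estimates and the Lasota–Yorke inequality. -/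

theorem norm_exp_mul_I_sub_le (s t : ℝ) :
    ‖Complex.exp (Complex.I * s) - Complex.exp (Complex.I * t)‖ ≤ |s - t| := by
  have h : Complex.exp (Complex.I * s) - Complex.exp (Complex.I * t) =
      Complex.exp (t * Complex.I) * (Complex.exp (Complex.I * (s - t : ℝ)) - 1) := by
    rw [mul_sub, ← Complex.exp_add, mul_one]
    push_cast
    ring_nf
  rw [h, norm_mul, Complex.norm_exp_ofReal_mul_I, one_mul]
  exact Real.norm_exp_I_mul_ofReal_sub_one_le

theorem abs_exp_sub_exp_le (s t : ℝ) :
    |Real.exp s - Real.exp t| ≤ (Real.exp s + Real.exp t) * |s - t| := by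
  wlog h : t ≤ s generalizing s t
  · rw [abs_sub_comm, abs_sub_comm s, add_comm]
    exact this t s (le_of_not_ge h)
  have h1 : Real.exp t = Real.exp s * Real.exp (t - s) := by rw [← Real.exp_add]; ring_nf
  rw [abs_of_nonneg (sub_nonneg.2 (Real.exp_le_exp.2 h)), abs_of_nonneg (sub_nonneg.2 h)]
  have h2 := mul_le_mul_of_nonneg_left (Real.add_one_le_exp (t - s)) (Real.exp_pos s).le
  nlinarith [mul_nonneg (Real.exp_pos t).le (sub_nonneg.2 h)]

theorem norm_exp_sub_exp_le (u u' v v' : ℝ) :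
    ‖Complex.exp (u + Complex.I * v) - Complex.exp (u' + Complex.I * v')‖ ≤
      (Real.exp u + Real.exp u') * (|u - u'| + |v - v'|) := by
  have h : Complex.exp (u + Complex.I * v) - Complex.exp (u' + Complex.I * v') =
      (Real.exp u : ℂ) * (Complex.exp (Complex.I * v) - Complex.exp (Complex.I * v')) +
        ((Real.exp u - Real.exp u' : ℝ) : ℂ) * Complex.exp (v' * Complex.I) := by
    rw [Complex.exp_add, Complex.exp_add, mul_comm (v' : ℂ)]
    push_cast
    ring
  rw [h]
  refine (norm_add_le _ _).trans ?_
  rw [norm_mul, norm_mul, Complex.norm_exp_ofReal_mul_I, Complex.norm_real, Complex.norm_real,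
    Real.norm_eq_abs, Real.norm_eq_abs, abs_of_pos (Real.exp_pos u), mul_one]
  have h1 := mul_le_mul_of_nonneg_left (norm_exp_mul_I_sub_le v v') (Real.exp_pos u).le
  have h2 := abs_exp_sub_exp_le u u'
  nlinarith [mul_nonneg (Real.exp_pos u').le (abs_nonneg (v - v'))]

/-- One step of the Lasota–Yorke inequality. -/
theorem norm_transfer_sub_le {lam : ℝ} (h0 : 0 < lam) (h1 : lam < 1) {φ w : Subshift A → ℝ}
    (hφ : ∀ x, transfer (fun y => (φ y : ℂ)) (fun _ => 1) x = 1) {K K' L S : ℝ}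
    (hK : 0 ≤ K) (hK' : 0 ≤ K') (hL : 0 ≤ L) (hS0 : 0 ≤ S)
    (hφK : ∀ x y, |φ x - φ y| ≤ K * shiftDist lam x y)
    (hw : ∀ x y, |w x - w y| ≤ K' * shiftDist lam x y)
    {h : Subshift A → ℂ} (hS : ∀ x, ‖h x‖ ≤ S)
    (hh : ∀ x y, ‖h x - h y‖ ≤ L * shiftDist lam x y) (x y : Subshift A) :
    ‖transfer (fun y => (φ y : ℂ) + Complex.I * w y) h x -
      transfer (fun y => (φ y : ℂ) + Complex.I * w y) h y‖ ≤
      (lam * L + 2 * (1 + K + K') * S) * shiftDist lam x y := by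
  by_cases hxy : x.1 0 = y.1 0
  swap
  -- At distance 1 the trivial bound 2S suffices; it accounts for the 1 in `1 + K + K'`.
  · rw [shiftDist_of_zero_ne lam hxy, mul_one]
    refine (norm_sub_le _ _).trans ?_
    have e1 := norm_transfer_le hφ w hS x
    have e2 := norm_transfer_le hφ w hS y
    nlinarith [mul_nonneg h0.le hL, mul_nonneg hK hS0, mul_nonneg hK' hS0]
  have hsx := sum_weights hφ x
  have hsy := sum_weights hφ y
  have hd := shiftDist_nonneg h0 x y
  set d := shiftDist lam x y with hddef
  have hterm : ∀ i : Fin N, ‖(if hi : A i (x.1 0) = 1 then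
        Complex.exp ((φ (cons i x hi) : ℂ) + Complex.I * w (cons i x hi)) *
          h (cons i x hi) else 0) - (if hi : A i (y.1 0) = 1 then
        Complex.exp ((φ (cons i y hi) : ℂ) + Complex.I * w (cons i y hi)) *
          h (cons i y hi) else 0)‖ ≤
      (if hi : A i (x.1 0) = 1 then Real.exp (φ (cons i x hi)) else 0) *
        ((lam * L + (K + K') * S) * d) +
      (if hi : A i (y.1 0) = 1 then Real.exp (φ (cons i y hi)) else 0) *
        ((K + K') * S * d) := by
    intro i
    by_cases hi : A i (x.1 0) = 1
    · have hi' : A i (y.1 0) = 1 := hxy ▸ hi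
      rw [dif_pos hi, dif_pos hi', dif_pos hi, dif_pos hi']
      set a := cons i x hi
      set a' := cons i y hi'
      have hda : shiftDist lam a a' ≤ lam * d := shiftDist_le_mul_shift h0 h1 (x := a) (y := a') rfl
      have hda1 : shiftDist lam a a' ≤ d := hda.trans (by nlinarith)
      have e1 : ‖h a - h a'‖ ≤ L * (lam * d) :=
        (hh a a').trans (mul_le_mul_of_nonneg_left hda hL)
      have e2 := norm_exp_sub_exp_le (φ a) (φ a') (w a) (w a')
      have e3 : |φ a - φ a'| + |w a - w a'| ≤ (K + K') * d := by
        have := (hφK a a').trans (mul_le_mul_of_nonneg_left hda1 hK)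
        have := (hw a a').trans (mul_le_mul_of_nonneg_left hda1 hK')
        linarith
      have e4 : ‖Complex.exp ((φ a : ℂ) + Complex.I * w a)‖ = Real.exp (φ a) := by
        rw [Complex.norm_exp]
        simp
      have e5 : Complex.exp ((φ a : ℂ) + Complex.I * w a) * h a -
          Complex.exp ((φ a' : ℂ) + Complex.I * w a') * h a' =
          Complex.exp ((φ a : ℂ) + Complex.I * w a) * (h a - h a') +
          (Complex.exp ((φ a : ℂ) + Complex.I * w a) -
            Complex.exp ((φ a' : ℂ) + Complex.I * w a')) * h a' := by ring
      rw [e5]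
      refine (norm_add_le _ _).trans ?_
      rw [norm_mul, norm_mul, e4]
      have e6 : ‖Complex.exp ((φ a : ℂ) + Complex.I * w a) -
            Complex.exp ((φ a' : ℂ) + Complex.I * w a')‖ * ‖h a'‖ ≤
          (Real.exp (φ a) + Real.exp (φ a')) * ((K + K') * d) * S :=
        mul_le_mul (e2.trans (mul_le_mul_of_nonneg_left e3 (by positivity))) (hS _)
          (norm_nonneg _) (by positivity)
      have e7 := mul_le_mul_of_nonneg_left e1 (Real.exp_pos (φ a)).le
      linarith
    · have hi' : ¬ A i (y.1 0) = 1 := hxy ▸ hi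
      simp [hi, hi']
  rw [transfer_eq_sum, transfer_eq_sum, ← Finset.sum_sub_distrib]
  refine (norm_sum_le _ _).trans ((Finset.sum_le_sum fun i _ => hterm i).trans ?_)
  rw [Finset.sum_add_distrib, ← Finset.sum_mul, ← Finset.sum_mul, hsx, hsy]
  nlinarith [mul_nonneg hS0 hd]

/-- The Lasota–Yorke inequality. -/
theorem norm_iterate_transfer_sub_le {lam : ℝ} (h0 : 0 < lam) (h1 : lam < 1)
    {φ w : Subshift A → ℝ}
    (hφ : ∀ x, transfer (fun y => (φ y : ℂ)) (fun _ => 1) x = 1) {K K' L S : ℝ}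
    (hK : 0 ≤ K) (hK' : 0 ≤ K') (hL : 0 ≤ L) (hS0 : 0 ≤ S)
    (hφK : ∀ x y, |φ x - φ y| ≤ K * shiftDist lam x y)
    (hw : ∀ x y, |w x - w y| ≤ K' * shiftDist lam x y)
    {h : Subshift A → ℂ} (hS : ∀ x, ‖h x‖ ≤ S)
    (hh : ∀ x y, ‖h x - h y‖ ≤ L * shiftDist lam x y) (M : ℕ) (x y : Subshift A) :
    ‖(transfer (fun y => (φ y : ℂ) + Complex.I * w y))^[M] h x -
      (transfer (fun y => (φ y : ℂ) + Complex.I * w y))^[M] h y‖ ≤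
      (lam ^ M * L + 2 * (1 + K + K') / (1 - lam) * S) * shiftDist lam x y := by
  have h2 : 0 < 1 - lam := by linarith
  induction M generalizing x y with
  | zero =>
    refine (hh x y).trans (mul_le_mul_of_nonneg_right ?_ (shiftDist_nonneg h0 x y))
    have : 0 ≤ 2 * (1 + K + K') / (1 - lam) * S := by positivity
    rw [pow_zero]
    linarith
  | succ M ih =>
    rw [Function.iterate_succ_apply']
    have h3 := norm_transfer_sub_le h0 h1 hφ hK hK' (L := lam ^ M * L +
      2 * (1 + K + K') / (1 - lam) * S) (by positivity) hS0 hφK hw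
      (norm_iterate_transfer_le hφ w hS M) ih x y
    -- The second term of the bound is the fixed point of the one-step recursion, so it does not
    -- grow with `M`.
    have h4 : lam * (lam ^ M * L + 2 * (1 + K + K') / (1 - lam) * S) + 2 * (1 + K + K') * S =
        lam ^ (M + 1) * L + 2 * (1 + K + K') / (1 - lam) * S := by
      field_simp
      ring
    rwa [h4] at h3

/-! ### From alignment to phases over periodic orbits. -/

/-- If an iterate of the twisted operator nearly attains the norm, then the phases over any two
`n`-periodic points nearly agree modulo `2π`. -/
theorem norm_exp_sub_one_le_of_large (hA01 : ∀ i j, A i j = 0 ∨ A i j = 1) {k : ℕ}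
    (hk : ∀ i j, 0 < (A ^ k) i j) {lam : ℝ} (h0 : 0 < lam) (h1 : lam < 1) {n : ℕ}
    {P Q : Subshift A} (hP : Function.IsPeriodicPt shift n P)
    (hQ : Function.IsPeriodicPt shift n Q) {φ : Subshift A → ℝ}
    (hφ : ∀ x, transfer (fun y => (φ y : ℂ)) (fun _ => 1) x = 1) {R : ℝ}
    (hR : ∀ x, -R ≤ φ x) {w : Subshift A → ℝ} {K : ℝ} (hK : 0 ≤ K)
    (hw : ∀ x y, |w x - w y| ≤ K * shiftDist lam x y)
    {h : Subshift A → ℂ} {S L : ℝ} (hS0 : 0 < S) (hL : 0 ≤ L) (hS : ∀ x, ‖h x‖ ≤ S)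
    (hh : ∀ x y, ‖h x - h y‖ ≤ L * S * shiftDist lam x y)
    {s t : ℕ} (hst : s ≤ t) {M : ℕ} (hM : M = n + (s + k) + (t + k))
    {ε δ : ℝ} (hδ : 0 ≤ δ) (hεδ : 2 * ε * Real.exp (M * R) ≤ δ ^ 2) (x : Subshift A)
    (hlarge : (1 - ε) * S ≤ ‖(transfer (fun y => (φ y : ℂ) + Complex.I * w y))^[M] h x‖) :
    ‖Complex.exp (Complex.I * (birkhoffSum shift w n P - birkhoffSum shift w n Q : ℝ)) - 1‖ ≤
      2 * δ + (L + 3 * K / (1 - lam)) * lam ^ s := by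
  obtain ⟨y, y', hy, hy', hd, hsum⟩ := exists_pair hA01 hk h0 h1 hP hQ hst x
  rw [← hM] at hy hy' hsum
  have hsum := hsum w K hK hw
  obtain ⟨c, hc, hcx⟩ := Complex.exists_norm_eq_mul_self
    ((transfer (fun y => (φ y : ℂ) + Complex.I * w y))^[M] h x)
  have hlarge' : (1 - ε) * S ≤
      (c * (transfer (fun y => (φ y : ℂ) + Complex.I * w y))^[M] h x).re := by
    rw [← hcx, Complex.ofReal_re]
    exact hlarge
  have e1 := norm_sub_le_of_large hφ hR w hS0.le hS hc hδ hεδ y (by rw [hy]; exact hlarge')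
  have e2 := norm_sub_le_of_large hφ hR w hS0.le hS hc hδ hεδ y' (by rw [hy']; exact hlarge')
  set W := birkhoffSum shift w M y
  set W' := birkhoffSum shift w M y'
  set D := birkhoffSum shift w n P - birkhoffSum shift w n Q
  have nW : ∀ v : ℝ, ‖Complex.exp (Complex.I * v)‖ = 1 := fun v => by
    rw [mul_comm, Complex.norm_exp_ofReal_mul_I]
  have e3 : ‖h y - h y'‖ ≤ L * S * lam ^ s :=
    (hh y y').trans (mul_le_mul_of_nonneg_left hd (by positivity))
  -- Multiplying each alignment error by the phase of the other point gives both values of `h` the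
  -- same coefficient, so only their difference remains.
  have e4 : (S : ℂ) * (Complex.exp (Complex.I * W) - Complex.exp (Complex.I * W')) =
      (c * Complex.exp (Complex.I * W) * h y - S) * Complex.exp (Complex.I * W') -
      (c * Complex.exp (Complex.I * W') * h y' - S) * Complex.exp (Complex.I * W) -
      c * Complex.exp (Complex.I * W) * Complex.exp (Complex.I * W') * (h y - h y') := by
    ring
  have e5 : S * ‖Complex.exp (Complex.I * W) - Complex.exp (Complex.I * W')‖ ≤
      δ * S + δ * S + L * S * lam ^ s := by
    have : S * ‖Complex.exp (Complex.I * W) - Complex.exp (Complex.I * W')‖ =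
        ‖(S : ℂ) * (Complex.exp (Complex.I * W) - Complex.exp (Complex.I * W'))‖ := by
      rw [norm_mul, Complex.norm_real, Real.norm_eq_abs, abs_of_pos hS0]
    rw [this, e4]
    refine (norm_sub_le _ _).trans (add_le_add ((norm_sub_le _ _).trans (add_le_add ?_ ?_)) ?_)
    · rw [norm_mul, nW, mul_one]; exact e1
    · rw [norm_mul, nW, mul_one]; exact e2
    · rw [norm_mul, norm_mul, norm_mul, nW, nW, hc]
      simpa using e3
  have e6 : ‖Complex.exp (Complex.I * W) - Complex.exp (Complex.I * W')‖ ≤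
      2 * δ + L * lam ^ s := by
    refine le_of_mul_le_mul_left (e5.trans (le_of_eq ?_)) hS0
    ring
  have e7 : ‖Complex.exp (Complex.I * (W - W' : ℝ)) - 1‖ ≤ 2 * δ + L * lam ^ s := by
    have : (Complex.exp (Complex.I * (W - W' : ℝ)) - 1) * Complex.exp (Complex.I * W') =
        Complex.exp (Complex.I * W) - Complex.exp (Complex.I * W') := by
      rw [sub_mul, ← Complex.exp_add, one_mul]
      push_cast
      ring_nf
    rw [← this, norm_mul, nW, mul_one] at e6
    exact e6
  have e8 := norm_exp_mul_I_sub_le D (W - W')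
  rw [abs_sub_comm] at e8
  have e9 := norm_sub_le_norm_sub_add_norm_sub (Complex.exp (Complex.I * D))
    (Complex.exp (Complex.I * (W - W' : ℝ))) 1
  have e10 : 3 * (K * lam ^ s / (1 - lam)) = 3 * K / (1 - lam) * lam ^ s := by ring
  linarith

/-- The chord has length 2|sin(s/2)|, and Jordan's inequality bounds it below. The bound by π holds
whatever `E` is, and later limits the size of the integer. -/
theorem exists_int_near {t E : ℝ} (h : ‖Complex.exp (Complex.I * t) - 1‖ ≤ E) :
    ∃ p : ℤ, |t - 2 * Real.pi * p| ≤ 2 * E ∧ |t - 2 * Real.pi * p| ≤ Real.pi := by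
  have hpi := Real.pi_pos
  refine ⟨round (t / (2 * Real.pi)), ?_⟩
  set p := round (t / (2 * Real.pi))
  have h1 : |t - 2 * Real.pi * p| ≤ Real.pi := by
    have h2 : t - 2 * Real.pi * p = 2 * Real.pi * (t / (2 * Real.pi) - p) := by field_simp
    rw [h2, abs_mul, abs_of_pos (by positivity)]
    have := abs_sub_round (t / (2 * Real.pi))
    nlinarith
  refine ⟨?_, h1⟩
  set s := t - 2 * Real.pi * p with hs
  have h3 : Complex.exp (Complex.I * t) = Complex.exp (Complex.I * s) := by
    rw [Complex.exp_eq_exp_iff_exists_int]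
    refine ⟨p, ?_⟩
    rw [hs]
    push_cast
    ring
  rw [h3, Complex.norm_exp_I_mul_ofReal_sub_one, Real.norm_eq_abs, abs_mul, abs_two] at h
  have h4 := Real.mul_abs_le_abs_sin (x := s / 2) (by
    rw [abs_div, abs_two]
    linarith)
  rw [abs_div, abs_two] at h4
  have h5 : 1 / 4 * |s| ≤ 2 / Real.pi * (|s| / 2) := by
    have h6 : 1 / 2 ≤ 2 / Real.pi := by
      rw [div_le_div_iff₀ two_pos hpi]
      linarith [Real.pi_le_four]
    nlinarith [abs_nonneg s]
  linarith

/-! ### Norms and the real phase. -/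

theorem IsLip.exists_nonneg {E : Type*} [NormedAddCommGroup E] {lam : ℝ} (h0 : 0 < lam)
    {f : Subshift A → E} (hf : IsLip lam f) :
    ∃ K : ℝ, 0 ≤ K ∧ ∀ x y, ‖f x - f y‖ ≤ K * shiftDist lam x y := by
  obtain ⟨K, hK⟩ := hf
  exact ⟨|K|, abs_nonneg _, fun x y => (hK x y).trans
    (mul_le_mul_of_nonneg_right (le_abs_self K) (shiftDist_nonneg h0 x y))⟩

/-- An unbounded real supremum has the default value 0, so boundedness must be shown; it follows
because the diameter is at most 1. -/
theorem IsLip.norm_le_supNorm {lam : ℝ} (h0 : 0 < lam) (h1 : lam < 1) {h : Subshift A → ℂ}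
    (hh : IsLip lam h) (x : Subshift A) : ‖h x‖ ≤ supNorm h := by
  obtain ⟨K, hK0, hK⟩ := hh.exists_nonneg h0
  refine le_ciSup (f := fun x => ‖h x‖) ⟨‖h x‖ + K, ?_⟩ x
  rintro _ ⟨y, rfl⟩
  have e1 := (hK y x).trans (mul_le_of_le_one_right hK0 (shiftDist_le_one h0 h1 y x))
  have e2 := norm_sub_norm_le (h y) (h x)
  change ‖h y‖ ≤ _
  linarith

theorem IsLip.norm_sub_le {lam : ℝ} (h0 : 0 < lam) {h : Subshift A → ℂ}
    (hh : IsLip lam h) (x y : Subshift A) :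
    ‖h x - h y‖ ≤ lipSeminorm lam h * shiftDist lam x y := by
  obtain ⟨K, hK0, hK⟩ := hh.exists_nonneg h0
  by_cases hxy : x = y
  · simp [hxy, shiftDist_self]
  rw [← div_le_iff₀ (shiftDist_pos h0 hxy)]
  refine le_ciSup (f := fun p : Subshift A × Subshift A =>
    ‖h p.1 - h p.2‖ / shiftDist lam p.1 p.2) ⟨K, ?_⟩ (x, y)
  rintro _ ⟨p, rfl⟩
  exact div_le_of_le_mul₀ (shiftDist_nonneg h0 _ _) hK0 (hK _ _)

theorem lipSeminorm_le {lam : ℝ} (h0 : 0 < lam) {h : Subshift A → ℂ} {K : ℝ} (hK0 : 0 ≤ K)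
    (hK : ∀ x y, ‖h x - h y‖ ≤ K * shiftDist lam x y) : lipSeminorm lam h ≤ K :=
  Real.iSup_le (fun _ => div_le_of_le_mul₀ (shiftDist_nonneg h0 _ _) hK0 (hK _ _)) hK0

/-- The real phase `-b r + m · Θ` of the twisted operator. -/
def phase {d : ℕ} (r : Subshift A → ℝ) (Θ : Subshift A → Fin d → ℝ) (b : ℝ) (m : Fin d → ℤ)
    (y : Subshift A) : ℝ := -b * r y + ∑ j, (m j : ℝ) * Θ y j

theorem twistedTransfer_eq {d : ℕ} (φ r : Subshift A → ℝ) (Θ : Subshift A → Fin d → ℝ)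
    (b : ℝ) (m : Fin d → ℤ) : twistedTransfer φ r Θ b m =
      transfer fun y => (φ y : ℂ) + Complex.I * phase r Θ b m y := by
  unfold twistedTransfer phase
  congr 1
  funext y
  push_cast
  ring

theorem one_le_l1Norm {d : ℕ} {m : Fin d → ℤ} (hm : m ≠ 0) : 1 ≤ l1Norm m := by
  obtain ⟨j, hj⟩ := Function.ne_iff.1 hm
  have h1 : (1 : ℝ) ≤ |(m j : ℝ)| := by exact_mod_cast Int.one_le_abs hj
  exact h1.trans (Finset.single_le_sum (f := fun j => |(m j : ℝ)|) (fun _ _ => abs_nonneg _)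
    (Finset.mem_univ j))

theorem exists_phase_lip {d : ℕ} {lam : ℝ} (h0 : 0 < lam) {r : Subshift A → ℝ}
    {Θ : Subshift A → Fin d → ℝ} (hr : IsLip lam r) (hΘ : ∀ j, IsLip lam fun x => Θ x j) :
    ∃ K : ℝ, 0 ≤ K ∧ ∀ (b : ℝ) (m : Fin d → ℤ) (x y : Subshift A),
      |phase r Θ b m x - phase r Θ b m y| ≤ K * (|b| + l1Norm m) * shiftDist lam x y := by
  obtain ⟨K, hK0, hK⟩ := hr.exists_nonneg h0
  choose K' hK0' hK' using fun j => (hΘ j).exists_nonneg h0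
  refine ⟨K + ∑ j, K' j, add_nonneg hK0 (Finset.sum_nonneg fun j _ => hK0' j), fun b m x y => ?_⟩
  have hd := shiftDist_nonneg h0 x y
  have e1 : phase r Θ b m x - phase r Θ b m y =
      -b * (r x - r y) + ∑ j, (m j : ℝ) * (Θ x j - Θ y j) := by
    simp only [phase, mul_sub, Finset.sum_sub_distrib]
    ring
  have e2 : |-b * (r x - r y)| ≤ (K + ∑ j, K' j) * shiftDist lam x y * |b| := by
    rw [abs_mul, abs_neg, mul_comm]
    refine mul_le_mul_of_nonneg_right ((hK x y).trans ?_) (abs_nonneg b)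
    exact mul_le_mul_of_nonneg_right
      (le_add_of_nonneg_right (Finset.sum_nonneg fun j _ => hK0' j)) hd
  have e3 : |∑ j, (m j : ℝ) * (Θ x j - Θ y j)| ≤
      (K + ∑ j, K' j) * shiftDist lam x y * l1Norm m := by
    refine (Finset.abs_sum_le_sum_abs _ _).trans ?_
    rw [l1Norm, Finset.mul_sum]
    refine Finset.sum_le_sum fun j _ => ?_
    rw [abs_mul, mul_comm]
    refine mul_le_mul_of_nonneg_right ((hK' j x y).trans ?_) (abs_nonneg _)
    refine mul_le_mul_of_nonneg_right ?_ hd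
    have := Finset.single_le_sum (f := K') (fun j _ => hK0' j) (Finset.mem_univ j)
    linarith
  rw [e1]
  refine (abs_add_le _ _).trans ((add_le_add e2 e3).trans (le_of_eq ?_))
  ring

theorem birkhoffSum_phase {d : ℕ} (r : Subshift A → ℝ) (Θ : Subshift A → Fin d → ℝ) (b : ℝ)
    (m : Fin d → ℤ) (n : ℕ) (x : Subshift A) :
    birkhoffSum shift (phase r Θ b m) n x =
      -b * birkhoffSum shift r n x + ∑ j, (m j : ℝ) * birkhoffSum shift Θ n x j := by
  simp only [birkhoffSum, phase, Finset.sum_add_distrib, Finset.mul_sum, Finset.sum_apply]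
  rw [Finset.sum_comm]

theorem abs_birkhoffSum_sub_le_mul {lam : ℝ} (h0 : 0 < lam) (h1 : lam < 1) {w : Subshift A → ℝ}
    {K : ℝ} (hK : 0 ≤ K) (hw : ∀ x y, |w x - w y| ≤ K * shiftDist lam x y) (n : ℕ)
    (x y : Subshift A) : |birkhoffSum shift w n x - birkhoffSum shift w n y| ≤ n * K := by
  rw [birkhoffSum, birkhoffSum, ← Finset.sum_sub_distrib]
  refine (Finset.abs_sum_le_sum_abs _ _).trans ?_
  refine (Finset.sum_le_card_nsmul _ _ K fun i _ => ?_).trans (by simp)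
  exact (hw _ _).trans (mul_le_of_le_one_right hK (shiftDist_le_one h0 h1 _ _))

/-! ### The Diophantine gap. -/

/-- By the Diophantine condition, the phases over the three periodic points cannot all nearly
agree modulo `2π`. -/
theorem exists_phase_gap {d n : ℕ} {lam : ℝ} (h0 : 0 < lam) (h1 : lam < 1) {r : Subshift A → ℝ}
    {Θ : Subshift A → Fin d → ℝ} {x₁ x₂ x₃ : Subshift A}
    (h_ne : birkhoffSum shift r n x₂ ≠ birkhoffSum shift r n x₃)
    (h_dioph : InhomDiophantine (alphaOf r n x₁ x₂ x₃) (betaOf r Θ n x₁ x₂ x₃))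
    {K : ℝ} (hK : 0 ≤ K) (hw : ∀ (b : ℝ) (m : Fin d → ℤ) (x y : Subshift A),
      |phase r Θ b m x - phase r Θ b m y| ≤ K * (|b| + l1Norm m) * shiftDist lam x y) :
    ∃ D > (0 : ℝ), ∃ γ > (0 : ℝ), ∀ (b : ℝ) (m : Fin d → ℤ) (B E : ℝ), m ≠ 0 →
      |b| + l1Norm m ≤ B →
      ‖Complex.exp (Complex.I * (birkhoffSum shift (phase r Θ b m) n x₁ -
        birkhoffSum shift (phase r Θ b m) n x₂ : ℝ)) - 1‖ ≤ E →
      ‖Complex.exp (Complex.I * (birkhoffSum shift (phase r Θ b m) n x₂ -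
        birkhoffSum shift (phase r Θ b m) n x₃ : ℝ)) - 1‖ ≤ E →
      D * B ^ (-γ) ≤ E := by
  obtain ⟨C, hC, γ, hγ, H⟩ := h_dioph
  set α := alphaOf r n x₁ x₂ x₃ with hα
  have hα1 : 0 < 1 + |α| := by positivity
  have hc : 0 < n * K + 2 := by positivity
  -- Here `(n * K + 2) * B` will dominate |q| + |m|, and `1 + |α|` is the cost of combining the two
  -- phase errors.
  refine ⟨C * (n * K + 2) ^ (-γ) / (1 + |α|), by positivity, γ, hγ, ?_⟩
  intro b m B E hm hB hE1 hE2
  obtain ⟨p, hp, -⟩ := exists_int_near hE1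
  obtain ⟨q, hq, hq'⟩ := exists_int_near hE2
  have hm1 := one_le_l1Norm hm
  have hB1 : 1 ≤ B := by linarith [abs_nonneg b]
  have hpi := Real.pi_gt_three
  set Δ := birkhoffSum shift (phase r Θ b m) n x₁ - birkhoffSum shift (phase r Θ b m) n x₂ with hΔ
  set Δ' := birkhoffSum shift (phase r Θ b m) n x₂ - birkhoffSum shift (phase r Θ b m) n x₃
    with hΔ'
  have hq1 : |(q : ℝ)| ≤ (n * K + 1) * B := by
    have e1 : |Δ'| ≤ n * (K * (|b| + l1Norm m)) :=
      abs_birkhoffSum_sub_le_mul h0 h1 (by positivity) (hw b m) n x₂ x₃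
    have e1' : |Δ'| ≤ n * (K * B) := e1.trans (by gcongr)
    have e2 : |2 * Real.pi * (q : ℝ)| ≤ |Δ'| + Real.pi := by
      have := abs_sub_abs_le_abs_sub (2 * Real.pi * (q : ℝ)) Δ'
      rw [abs_sub_comm (2 * Real.pi * (q : ℝ))] at this
      linarith
    rw [abs_mul, abs_of_pos (by positivity)] at e2
    have e3 : 0 ≤ n * (K * B) := by positivity
    by_contra! hlt
    have e4 : 2 * Real.pi * ((n * K + 1) * B) < 2 * Real.pi * |(q : ℝ)| := by gcongr
    nlinarith
  -- The contribution of `b` cancels because α(ℓ₂ - ℓ₃) = ℓ₁ - ℓ₂.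
  have key : q * α + ∑ j, (m j : ℝ) * betaOf r Θ n x₁ x₂ x₃ j - p =
      ((Δ - 2 * Real.pi * p) - α * (Δ' - 2 * Real.pi * q)) / (2 * Real.pi) := by
    have hα2 : α * (birkhoffSum shift r n x₂ - birkhoffSum shift r n x₃) =
        birkhoffSum shift r n x₁ - birkhoffSum shift r n x₂ :=
      div_mul_cancel₀ _ (sub_ne_zero.2 h_ne)
    have hβ : ∑ j, (m j : ℝ) * betaOf r Θ n x₁ x₂ x₃ j =
        ((∑ j, (m j : ℝ) * birkhoffSum shift Θ n x₁ j - ∑ j, (m j : ℝ) * birkhoffSum shift Θ n x₂ j)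
          - α * (∑ j, (m j : ℝ) * birkhoffSum shift Θ n x₂ j -
            ∑ j, (m j : ℝ) * birkhoffSum shift Θ n x₃ j)) / (2 * Real.pi) := by
      simp only [← Finset.sum_sub_distrib, Finset.mul_sum, Finset.sum_div, betaOf, ← hα]
      refine Finset.sum_congr rfl fun j _ => ?_
      ring
    rw [hβ, hΔ, hΔ']
    simp only [birkhoffSum_phase]
    field_simp
    linear_combination (-b) * hα2
  have h2 := H p q m (Or.inr hm)
  rw [key, abs_div, abs_of_pos (show 0 < 2 * Real.pi by positivity)] at h2
  have h3 : |(Δ - 2 * Real.pi * p) - α * (Δ' - 2 * Real.pi * q)| ≤ (1 + |α|) * (2 * E) := by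
    refine (abs_sub _ _).trans ?_
    rw [abs_mul]
    nlinarith [abs_nonneg α]
  have hE0 : 0 ≤ E := (norm_nonneg _).trans hE1
  have h4 : C * (|(q : ℝ)| + l1Norm m) ^ (-γ) ≤ (1 + |α|) * E := by
    refine h2.trans ?_
    rw [div_le_iff₀ (by positivity)]
    refine h3.trans ?_
    nlinarith [mul_nonneg hα1.le hE0]
  have h5 : ((n * K + 2) * B) ^ (-γ) ≤ (|(q : ℝ)| + l1Norm m) ^ (-γ) := by
    refine Real.rpow_le_rpow_of_nonpos (by positivity) ?_ (by linarith)
    linarith [abs_nonneg b]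
  rw [Real.mul_rpow hc.le (by linarith)] at h5
  rw [div_mul_eq_mul_div, div_le_iff₀ hα1]
  nlinarith [mul_le_mul_of_nonneg_left h5 hC.le]

/-! ### Choice of the constants. -/

/-- Since `B` stays above `C₁ > 1`, any constant can be absorbed by enlarging the exponent, without
a lower threshold on `B`. -/
theorem exists_rpow_small {C₁ : ℝ} (hC₁ : 1 < C₁) (C : ℝ) :
    ∃ T > (0 : ℝ), ∀ t ≥ T, ∀ B ≥ C₁, C * B ^ (-t) ≤ 1 := by
  obtain ⟨n, hn⟩ := pow_unbounded_of_one_lt C hC₁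
  refine ⟨n + 1, by positivity, fun t ht B hB => ?_⟩
  have hB0 : 0 < B := by linarith
  rw [Real.rpow_neg hB0.le, ← div_eq_mul_inv, div_le_one (by positivity)]
  calc C ≤ C₁ ^ n := hn.le
    _ ≤ B ^ n := by gcongr
    _ = B ^ (n : ℝ) := (Real.rpow_natCast _ _).symm
    _ ≤ B ^ t := Real.rpow_le_rpow_of_exponent_le (by linarith) (by linarith)

theorem exists_constants {C₁ lam D γ : ℝ} (hC₁ : 1 < C₁) (h0 : 0 < lam) (h1 : lam < 1)
    (hD : 0 < D) (hγ : 0 < γ) {R G : ℝ} (hR : 0 ≤ R) (hG : 0 ≤ G) (n k : ℕ) :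
    ∃ C₂ > (0 : ℝ), ∃ C₃ > (0 : ℝ), ∀ B ≥ C₁, ∃ s t : ℕ, ∃ δ : ℝ,
      s ≤ t ∧ ⌊C₂ * Real.log B⌋₊ = n + (s + k) + (t + k) ∧
      lam ^ ⌊C₂ * Real.log B⌋₊ ≤ 1 / 4 ∧ B ^ (-C₃) ≤ 1 / 2 ∧ 0 ≤ δ ∧
      2 * B ^ (-C₃) * Real.exp (⌊C₂ * Real.log B⌋₊ * R) ≤ δ ^ 2 ∧
      2 * δ + G * B * lam ^ s < D * B ^ (-γ) := by
  obtain ⟨κ, hκ⟩ : ∃ κ, κ = -Real.log lam := ⟨_, rfl⟩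
  have hκ0 : 0 < κ := by rw [hκ]; exact neg_pos.2 (Real.log_neg h0 h1)
  have hlam : ∀ j : ℕ, lam ^ j = Real.exp (-κ * j) := fun j => by
    rw [hκ, neg_neg, mul_comm, Real.exp_nat_mul, Real.exp_log h0]
  -- `H` covers the gaps, the extra period and the rounding when lam^s is compared with B^(-κC₂/2).
  set H := Real.exp (κ * (n + 2 * k + 3) / 2) with hH
  obtain ⟨T₁, hT₁, H₁⟩ := exists_rpow_small hC₁ (4 * G * H / D)
  obtain ⟨T₂, hT₂, H₂⟩ := exists_rpow_small hC₁ (4 * H)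
  obtain ⟨T₃, hT₃, H₃⟩ := exists_rpow_small hC₁ (128 / D ^ 2)
  obtain ⟨T₄, hT₄, H₄⟩ := exists_rpow_small hC₁ 2
  have hl : 0 < Real.log C₁ := Real.log_pos hC₁
  -- The first term makes B·lam^s small against B^(-γ), the 1 paying for the factor B. The second
  -- leaves room for the period and both gaps.
  obtain ⟨C₂, hC₂⟩ : ∃ C₂, C₂ = 2 / κ * (T₁ + T₂ + 1 + γ) + (n + 2 * k + 1) / Real.log C₁ :=
    ⟨_, rfl⟩
  have hC₂0 : 0 < C₂ := by rw [hC₂]; positivity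
  have hC₂κ : T₁ + T₂ + 1 + γ ≤ κ * C₂ / 2 := by
    have e : κ * C₂ / 2 = T₁ + T₂ + 1 + γ + κ * ((n + 2 * k + 1) / Real.log C₁) / 2 := by
      rw [hC₂]; field_simp
    rw [e]
    exact le_add_of_nonneg_right (by positivity)
  have hC₂l : n + 2 * k + 1 ≤ C₂ * Real.log C₁ := by
    have e : C₂ * Real.log C₁ = 2 / κ * (T₁ + T₂ + 1 + γ) * Real.log C₁ + (n + 2 * k + 1) := by
      rw [hC₂]; field_simp
    rw [e]
    exact le_add_of_nonneg_left (by positivity)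
  -- `C₂ * R` pays for the smallest weight, and `2 * γ` for δ², with δ of order B^(-γ).
  refine ⟨C₂, hC₂0, T₃ + T₄ + C₂ * R + 2 * γ, by positivity, fun B hB => ?_⟩
  have hB0 : 0 < B := by linarith
  have hB1 : 1 ≤ B := by linarith
  have hlB : Real.log C₁ ≤ Real.log B := Real.log_le_log (by linarith) hB
  have hBexp : ∀ t : ℝ, B ^ t = Real.exp (Real.log B * t) := fun t => Real.rpow_def_of_pos hB0 t
  set M := ⌊C₂ * Real.log B⌋₊ with hM
  have hM1 : (M : ℝ) ≤ C₂ * Real.log B := Nat.floor_le (by nlinarith)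
  have hM2 : C₂ * Real.log B < M + 1 := Nat.lt_floor_add_one _
  have hM3 : n + 2 * k ≤ M := by
    have : (n + 2 * k + 1 : ℝ) < M + 1 :=
      (hC₂l.trans (mul_le_mul_of_nonneg_left hlB hC₂0.le)).trans_lt hM2
    have : ((n + 2 * k : ℕ) : ℝ) < M := by push_cast; linarith
    exact_mod_cast this.le
  obtain ⟨s, hs⟩ : ∃ s, s = (M - n - 2 * k) / 2 := ⟨_, rfl⟩
  have hs2 : M ≤ 2 * s + n + 2 * k + 1 := by omega
  have hs3 : (M : ℝ) ≤ 2 * s + n + 2 * k + 1 := by exact_mod_cast hs2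
  have hlams : lam ^ s ≤ H * B ^ (-(κ * C₂ / 2)) := by
    rw [hlam, hBexp, hH, ← Real.exp_add, Real.exp_le_exp]
    nlinarith
  refine ⟨s, M - n - 2 * k - s, D / 8 * B ^ (-γ), by omega, by omega, ?_, ?_, by positivity, ?_, ?_⟩
  · have e1 : lam ^ M ≤ lam ^ s := pow_le_pow_of_le_one h0.le h1.le (by omega)
    have e2 := H₂ (κ * C₂ / 2) (by linarith) B hB
    linarith
  · have e2 := H₄ (T₃ + T₄ + C₂ * R + 2 * γ) (by nlinarith) B hB
    linarith
  · have e1 : Real.exp (M * R) ≤ B ^ (C₂ * R) := by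
      rw [hBexp, Real.exp_le_exp]
      nlinarith
    have e2 := H₃ (T₃ + T₄) (by linarith) B hB
    have e3 : B ^ (-(T₃ + T₄)) ≤ D ^ 2 / 128 := by
      have hD2 : 0 < D ^ 2 := by positivity
      rw [div_mul_eq_mul_div, div_le_one hD2] at e2
      linarith
    calc 2 * B ^ (-(T₃ + T₄ + C₂ * R + 2 * γ)) * Real.exp (M * R)
        ≤ 2 * B ^ (-(T₃ + T₄ + C₂ * R + 2 * γ)) * B ^ (C₂ * R) := by gcongr
      _ = 2 * B ^ (-(T₃ + T₄)) * (B ^ (-γ)) ^ 2 := by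
        rw [pow_two, mul_assoc, mul_assoc, ← Real.rpow_add hB0, ← Real.rpow_add hB0,
          ← Real.rpow_add hB0]
        ring_nf
      _ ≤ 2 * (D ^ 2 / 128) * (B ^ (-γ)) ^ 2 := by gcongr
      _ = (D / 8 * B ^ (-γ)) ^ 2 := by ring
  · have e2 := H₁ (κ * C₂ / 2 - 1 - γ) (by linarith) B hB
    have e3 : G * H * B ^ (-(κ * C₂ / 2 - 1 - γ)) ≤ D / 4 := by
      rw [div_mul_eq_mul_div, div_le_one hD] at e2
      linarith
    have e4 : G * B * lam ^ s ≤ D / 4 * B ^ (-γ) := by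
      calc G * B * lam ^ s ≤ G * B * (H * B ^ (-(κ * C₂ / 2))) := by gcongr
        _ = G * H * B ^ (-(κ * C₂ / 2 - 1 - γ)) * B ^ (-γ) := by
          have : B * B ^ (-(κ * C₂ / 2)) = B ^ (-(κ * C₂ / 2 - 1 - γ)) * B ^ (-γ) := by
            rw [← Real.rpow_add hB0]
            nth_rewrite 1 [← Real.rpow_one B]
            rw [← Real.rpow_add hB0]
            ring_nf
          linear_combination G * H * this
        _ ≤ D / 4 * B ^ (-γ) := by gcongr
    have e5 : 0 < D * B ^ (-γ) := by positivity
    linarith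

end TorusExt

/-! ### The contraction estimate. -/

theorem proposition3p5 {N d : ℕ} (A : Matrix (Fin N) (Fin N) ℤ)
    (hA01 : ∀ i j, A i j = 0 ∨ A i j = 1) (hA : A.IsPrimitive)
    (lam : ℝ) (hlam0 : 0 < lam) (hlam1 : lam < 1)
    (φ r : TorusExt.Subshift A → ℝ) (Θ : TorusExt.Subshift A → Fin d → ℝ)
    (hφ : TorusExt.IsLip lam φ) (hr : TorusExt.IsLip lam r) (hr_pos : ∀ x, 0 < r x)
    (hΘ : ∀ j, TorusExt.IsLip lam (fun x => Θ x j))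
    (hφ_norm : ∀ x, TorusExt.transfer (fun y => (φ y : ℂ)) (fun _ => 1) x = 1)
    (n : ℕ) (hn : 0 < n) (x₁ x₂ x₃ : TorusExt.Subshift A)
    (hx₁ : Function.IsPeriodicPt TorusExt.shift n x₁)
    (hx₂ : Function.IsPeriodicPt TorusExt.shift n x₂)
    (hx₃ : Function.IsPeriodicPt TorusExt.shift n x₃)
    (h_ne : birkhoffSum TorusExt.shift r n x₂ ≠ birkhoffSum TorusExt.shift r n x₃)
    (h_dioph : TorusExt.InhomDiophantine (TorusExt.alphaOf r n x₁ x₂ x₃)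
      (TorusExt.betaOf r Θ n x₁ x₂ x₃))
    (C₁ : ℝ) (hC₁ : 1 < C₁) :
    ∃ C₂ > (0 : ℝ), ∃ C₃ > (0 : ℝ), ∃ C₄ > (0 : ℝ),
      ∀ (b : ℝ) (m : Fin d → ℤ), m ≠ 0 → ∀ h : TorusExt.Subshift A → ℂ, TorusExt.IsLip lam h →
        TorusExt.IsLip lam
          ((TorusExt.twistedTransfer φ r Θ b m)^[⌊C₂ * Real.log (TorusExt.freq C₁ b m)⌋₊] h) ∧
        TorusExt.freqNorm lam C₄ (TorusExt.freq C₁ b m)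
          ((TorusExt.twistedTransfer φ r Θ b m)^[⌊C₂ * Real.log (TorusExt.freq C₁ b m)⌋₊] h)
          ≤ (1 - TorusExt.freq C₁ b m ^ (-C₃)) *
            TorusExt.freqNorm lam C₄ (TorusExt.freq C₁ b m) h := by
  open TorusExt in
  obtain ⟨-, k, -, hk⟩ := hA
  have h2 : 0 < 1 - lam := by linarith
  obtain ⟨Kφ, hKφ0, hKφ⟩ := hφ.exists_nonneg hlam0
  obtain ⟨K, hK0, hK⟩ := exists_phase_lip hlam0 hr hΘ
  obtain ⟨D, hD, γ, hγ, hgap⟩ := exists_phase_gap hlam0 hlam1 h_ne h_dioph hK0 hK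
  obtain ⟨R, hR0, hR⟩ : ∃ R : ℝ, 0 ≤ R ∧ ∀ x, -R ≤ φ x := by
    refine ⟨|φ x₁| + Kφ, by positivity, fun x => ?_⟩
    have e1 := (hKφ x₁ x).trans (mul_le_of_le_one_right hKφ0 (shiftDist_le_one hlam0 hlam1 _ _))
    rw [Real.norm_eq_abs] at e1
    linarith [neg_abs_le (φ x₁), le_abs_self (φ x₁ - φ x)]
  -- With B ≥ 1 the additive Lasota–Yorke term is at most a quarter of C₄BS; lam^M ≤ 1/4 gives
  -- another quarter, and B^(-C₃) ≤ 1/2 leaves room for their sum.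
  obtain ⟨C₄, hC₄⟩ : ∃ C₄, C₄ = 4 * (2 * (1 + Kφ + K) / (1 - lam)) := ⟨_, rfl⟩
  have hC₄0 : 0 < C₄ := by rw [hC₄]; positivity
  obtain ⟨C₂, hC₂, C₃, hC₃, hconst⟩ := exists_constants hC₁ hlam0 hlam1 hD hγ hR0
    (G := C₄ + 3 * K / (1 - lam)) (by positivity) n k
  refine ⟨C₂, hC₂, C₃, hC₃, C₄, hC₄0, fun b m hm h hh => ?_⟩
  have hm1 := one_le_l1Norm hm
  have hBm : |b| + l1Norm m ≤ freq C₁ b m := by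
    rw [freq]
    nlinarith
  have hBC : C₁ ≤ freq C₁ b m := by
    rw [freq]
    nlinarith [abs_nonneg b]
  obtain ⟨s, t, δ, hst, hM, hlamM, hε, hδ, hεδ, hsmall⟩ := hconst _ hBC
  set B := freq C₁ b m
  set M := ⌊C₂ * Real.log B⌋₊
  have hB1 : 1 ≤ B := by linarith
  have hB0 : 0 < B := by linarith
  rw [twistedTransfer_eq]
  set w := phase r Θ b m
  have hw : ∀ x y, |w x - w y| ≤ K * B * shiftDist lam x y := fun x y =>
    (hK b m x y).trans (mul_le_mul_of_nonneg_right (mul_le_mul_of_nonneg_left hBm hK0)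
      (shiftDist_nonneg hlam0 x y))
  set S := freqNorm lam C₄ B h with hSdef
  have hS : ∀ x, ‖h x‖ ≤ S := fun x =>
    (hh.norm_le_supNorm hlam0 hlam1 x).trans (le_max_left _ _)
  have hS0 : 0 ≤ S := (norm_nonneg _).trans (hS x₁)
  have hLip : lipSeminorm lam h ≤ C₄ * B * S := by
    have : lipSeminorm lam h / (C₄ * B) ≤ S := le_max_right _ _
    rw [div_le_iff₀ (by positivity)] at this
    linarith
  have hhS : ∀ x y, ‖h x - h y‖ ≤ C₄ * B * S * shiftDist lam x y := fun x y =>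
    (hh.norm_sub_le hlam0 x y).trans (mul_le_mul_of_nonneg_right hLip (shiftDist_nonneg hlam0 x y))
  have hLY := norm_iterate_transfer_sub_le hlam0 hlam1 hφ_norm hKφ0 (mul_nonneg hK0 hB0.le)
    (mul_nonneg (mul_nonneg hC₄0.le hB0.le) hS0) hS0 hKφ hw hS hhS M
  refine ⟨⟨_, hLY⟩, max_le ?_ ?_⟩
  · have : Nonempty (Subshift A) := ⟨x₁⟩
    refine ciSup_le fun x => ?_
    -- The alignment argument divides by `S`, so S = 0 is separate.
    rcases hS0.eq_or_lt with hS00 | hSpos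
    · have := norm_iterate_transfer_le hφ_norm w hS M x
      rw [← hS00] at this ⊢
      simpa using this
    by_contra! hlt
    have key : ∀ {P Q : Subshift A}, Function.IsPeriodicPt shift n P →
        Function.IsPeriodicPt shift n Q → _ := fun hP hQ =>
      norm_exp_sub_one_le_of_large hA01 hk hlam0 hlam1 hP hQ hφ_norm hR
        (mul_nonneg hK0 hB0.le) hw hSpos (mul_nonneg hC₄0.le hB0.le) hS hhS hst hM hδ hεδ x hlt.le
    have e := hgap b m B _ hm hBm (key hx₁ hx₂) (key hx₂ hx₃)
    have e2 : (C₄ * B + 3 * (K * B) / (1 - lam)) * lam ^ s =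
        (C₄ + 3 * K / (1 - lam)) * B * lam ^ s := by ring
    rw [e2] at e
    linarith
  · rw [div_le_iff₀ (by positivity)]
    have e1 : 2 * (1 + Kφ + K * B) / (1 - lam) ≤ C₄ / 4 * B := by
      rw [hC₄, div_le_iff₀ h2]
      field_simp
      nlinarith
    have e0 : 0 ≤ C₄ * B * S := by positivity
    refine (lipSeminorm_le hlam0 ?_ hLY).trans ?_
    · have : 0 ≤ 2 * (1 + Kφ + K * B) / (1 - lam) * S := by positivity
      have : 0 ≤ lam ^ M * (C₄ * B * S) := by positivity
      linarith
    · have e3 := mul_le_mul_of_nonneg_right e1 hS0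
      have e4 := mul_le_mul_of_nonneg_right hlamM e0
      have e5 := mul_le_mul_of_nonneg_right hε e0
      linarith
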